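/- Let $q$ be a prime power and let $\mathcal S_{3,q}$ be the set of symmetric $3\times 3$ matrices over the finite field $\mathrm{GF}(q)$, with the rank distance $d_r(A,B)=\mathrm{rk}(A-B)$. Let $\mathcal C\subseteq\mathcal S_{3,q}$ be a $2$-code, that is, a non-empty set whose minimum distance $\min\{d_r(A,B) : A,B\in\mathcal C,\ A\neq B\}$ equals $2$; more generally, let $\mathcal C\subseteq\mathcal S_{3,q}$ be any non-empty set in which any two distinct elements have rank distance at least $2$. Then $$|\mathcal C|\le \frac{q(q^2-1)(q^2+q+1)}{2}+1 .$$ -/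

import Mathlib

/-- The set of symmetric `n × n` matrices with entries in `F`. -/
abbrev SymMat (n : ℕ) (F : Type*) : Type _ :=
  {A : Matrix (Fin n) (Fin n) F // A.IsSymm}

/-- The rank distance `rk (A - B)` of two symmetric matrices. -/
noncomputable def rankDist {n : ℕ} {F : Type*} [Field F] (A B : SymMat n F) : ℕ :=
  (A.1 - B.1).rank

/-- The minimum distance of a code: the minimum of the rank distances of two distinct codewords.
A code with a single word has no such pair, and its minimum distance is `⊤`. -/
noncomputable def minRankDist {n : ℕ} {F : Type*} [Field F] (C : Set (SymMat n F)) : ℕ∞ :=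
  ⨅ (A ∈ C) (B ∈ C) (_ : A ≠ B), (rankDist A B : ℕ∞)

/-- A `d`-code of symmetric matrices: a non-empty set of symmetric matrices
whose minimum distance is `d`. -/
structure IsDCode {n : ℕ} {F : Type*} [Field F] (d : ℕ∞) (C : Set (SymMat n F)) : Prop where
  nonempty : C.Nonempty
  minDist : minRankDist C = d

/-!
A code of minimum distance at least `2` is an independent set in the Cayley graph on the additive
group of symmetric `3 × 3` matrices whose connection set is the set of matrices of rank one. The
bound is the inertia bound for this graph: an independent set has at most as many elements as
the adjacency operator has nonnegative eigenvalues, because the Hermitian form attached to that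
operator vanishes on functions supported on an independent set
(`card_le_of_re_eigenvalue_neg`).

The characters of the group are indexed by ternary quadratic forms `Q`, in every characteristic:
a matrix is recorded by its six entries on and above the diagonal, a form by its six coefficients,
and the matrix `c • v vᵀ` pairs with `Q` to `c * Q(v)`. Every matrix `c • v vᵀ` with `c ≠ 0`
and `v ≠ 0` is counted once for each such pair `(v, c)`, which multiplies the eigenvalues by
`q - 1` and leaves their signs alone. The eigenvalue at `Q` is then `q * Z - q ^ 3 - (q - 1)`,
where `Z` is the number of zeros of `Q` in `F ^ 3`; it is negative as soon as `Z ≤ q ^ 2`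
(`re_sum_veronese_neg`).

It remains to bound the number of forms with more than `q ^ 2` zeros. Such a form is zero or a
product of two linearly independent linear forms (`exists_linearIndependent_eq_linearProd`): it has
a zero `x` whose tangent plane is proper, there are too many zeros for all of those in the tangent
plane to be multiples of `x`, so the form vanishes on the whole plane and is divisible by the
equation of that plane. Each product arises from at least `2 * (q - 1)` of the
`(q ^ 3 - 1) * (q ^ 3 - q)` ordered pairs of independent linear forms
(`two_mul_le_card_fiber`), so there are at most `q * (q ^ 2 - 1) * (q ^ 2 + q + 1) / 2` nonzero
forms of this kind, and the zero form accounts for the last summand `1`.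
-/

open Finset

/-! ### The inertia bound for Cayley graphs on `ι → F` -/

theorem sum_addChar_dotProduct {F : Type*} [Field F] [Fintype F] {ι : Type*} [Fintype ι]
    [DecidableEq ι] [DecidableEq F] {ψ : AddChar F ℂ} (hψ : ψ.IsPrimitive) (x : ι → F) :
    ∑ Q : ι → F, ψ (Q ⬝ᵥ x) = if x = 0 then (Fintype.card (ι → F) : ℂ) else 0 := by
  split_ifs with h
  · simp [h]
  · obtain ⟨i, hi⟩ := Function.ne_iff.1 h
    let χ : AddChar (ι → F) ℂ :=
      { toFun := fun Q => ψ (Q ⬝ᵥ x)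
        map_zero_eq_one' := by simp
        map_add_eq_mul' := fun a b => by rw [add_dotProduct, AddChar.map_add_eq_mul] }
    have hχ : χ ≠ 1 := by
      obtain ⟨a, ha⟩ := AddChar.ne_one_iff.1 (hψ hi)
      refine AddChar.ne_one_iff.2 ⟨Pi.single i a, ?_⟩
      simpa [χ, AddChar.mulShift_apply, mul_comm] using ha
    exact AddChar.sum_eq_zero_of_ne_one hχ

/-- The inertia bound for the Cayley graph on `ι → F` with connection family `t`. The eigenvalue at
the character `Q` is `∑ s, ψ (Q ⬝ᵥ t s)`; the hypotheses say that `C` is independent and that the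
eigenvalues outside `P` have negative real part. If `C` had more elements than `P`, some nonzero
function supported on `C` would have its Fourier transform vanish on `P`, and the Hermitian form of
the graph would be both zero and negative on it. -/
theorem card_le_of_re_eigenvalue_neg {F : Type*} [Field F] [Fintype F] {ι τ : Type*} [Fintype ι]
    [Fintype τ] {ψ : AddChar F ℂ} (hψ : ψ.IsPrimitive) (t : τ → ι → F)
    (C P : Finset (ι → F)) (hC : ∀ A ∈ C, ∀ B ∈ C, ∀ s, A - B + t s ≠ 0)
    (hP : ∀ Q ∉ P, (∑ s, ψ (Q ⬝ᵥ t s)).re < 0) : #C ≤ #P := by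
  classical
  by_contra! hlt
  -- The Fourier transform of a function supported on `C`, restricted to `P`.
  let T : (C → ℂ) →ₗ[ℂ] (P → ℂ) :=
    { toFun := fun f Q => ∑ A : C, f A * ψ (Q.1 ⬝ᵥ A.1)
      map_add' := fun f g => by ext; simp [add_mul, sum_add_distrib]
      map_smul' := fun c f => by ext; simp [mul_sum, mul_assoc] }
  have hker : LinearMap.ker T ≠ ⊥ := LinearMap.ker_ne_bot_of_finrank_lt (by simpa using hlt)
  obtain ⟨f, hf, hf0⟩ := (Submodule.ne_bot_iff _).1 hker
  let g : (ι → F) → ℂ := fun Q => ∑ A : C, f A * ψ (Q ⬝ᵥ A.1)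
  have hg : ∀ Q ∈ P, g Q = 0 := fun Q hQ => congrFun (LinearMap.mem_ker.1 hf) ⟨Q, hQ⟩
  -- The Hermitian form of the graph at `f`, computed on the Fourier side, vanishes since `C` is
  -- independent.
  have key : ∑ Q : ι → F, (∑ s, ψ (Q ⬝ᵥ t s)) * (g Q * (starRingEnd ℂ) (g Q)) = 0 := by
    calc _ = ∑ Q : ι → F, ∑ s, ∑ A : C, ∑ B : C,
          f A * (starRingEnd ℂ) (f B) * ψ (Q ⬝ᵥ (A.1 - B.1 + t s)) := by
          refine sum_congr rfl fun Q _ => ?_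
          simp only [g, map_sum, sum_mul_sum, map_mul, ← AddChar.map_neg_eq_conj]
          refine sum_congr rfl fun s _ => ?_
          simp only [mul_sum]
          refine sum_congr rfl fun A _ => sum_congr rfl fun B _ => ?_
          rw [dotProduct_add, dotProduct_sub, sub_eq_add_neg, AddChar.map_add_eq_mul,
            AddChar.map_add_eq_mul]
          ring
      _ = ∑ s, ∑ A : C, ∑ B : C, f A * (starRingEnd ℂ) (f B) *
            ∑ Q : ι → F, ψ (Q ⬝ᵥ (A.1 - B.1 + t s)) := by
          rw [sum_comm]
          refine sum_congr rfl fun s _ => ?_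
          rw [sum_comm]
          refine sum_congr rfl fun A _ => ?_
          rw [sum_comm]
          simp only [mul_sum]
      _ = 0 := by
          refine sum_eq_zero fun s _ => sum_eq_zero fun A _ => sum_eq_zero fun B _ => ?_
          rw [sum_addChar_dotProduct hψ, if_neg (hC A.1 A.2 B.1 B.2 s), mul_zero]
  have hre : ∑ Q : ι → F, (∑ s, ψ (Q ⬝ᵥ t s)).re * Complex.normSq (g Q) = 0 := by
    have := congrArg Complex.re key
    simpa only [Complex.re_sum, Complex.mul_conj, Complex.re_mul_ofReal, Complex.zero_re] using this
  have hterm : ∀ Q ∈ (univ : Finset (ι → F)),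
      (∑ s, ψ (Q ⬝ᵥ t s)).re * Complex.normSq (g Q) ≤ 0 := by
    intro Q _
    by_cases hQ : Q ∈ P
    · simp [hg Q hQ]
    · exact mul_nonpos_of_nonpos_of_nonneg (hP Q hQ).le (Complex.normSq_nonneg _)
  have hzero : ∀ Q, g Q = 0 := by
    intro Q
    by_cases hQ : Q ∈ P
    · exact hg Q hQ
    · have := (sum_eq_zero_iff_of_nonpos hterm).1 hre Q (mem_univ _)
      exact Complex.normSq_eq_zero.1 ((mul_eq_zero.1 this).resolve_left (hP Q hQ).ne)
  apply hf0
  ext A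
  -- Fourier inversion recovers `f` from `g`.
  have hinv : ∑ Q : ι → F, g Q * ψ (-(Q ⬝ᵥ A.1)) = Fintype.card (ι → F) * f A := by
    calc _ = ∑ B : C, f B * ∑ Q : ι → F, ψ (Q ⬝ᵥ (B.1 - A.1)) := by
          simp only [g, sum_mul, mul_sum]
          rw [sum_comm]
          refine sum_congr rfl fun B _ => sum_congr rfl fun Q _ => ?_
          rw [dotProduct_sub, sub_eq_add_neg, AddChar.map_add_eq_mul, mul_assoc]
      _ = _ := by
          simp only [sum_addChar_dotProduct hψ, sub_eq_zero, Subtype.coe_inj]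
          simp [mul_comm]
  simp only [hzero, zero_mul, sum_const_zero] at hinv
  exact (mul_eq_zero.1 hinv.symm).resolve_left (Nat.cast_ne_zero.2 Fintype.card_ne_zero)

/-! ### Ternary quadratic forms by coefficients -/

/-- The monomials `x², y², z², yz, xz, xy` at a vector. A ternary quadratic form is encoded as its
vector `Q : Fin 6 → F` of coefficients in this order, and its value at `v` is `Q ⬝ᵥ veronese v`. -/
def veronese {F : Type*} [Field F] (v : Fin 3 → F) : Fin 6 → F :=
  ![v 0 ^ 2, v 1 ^ 2, v 2 ^ 2, v 1 * v 2, v 0 * v 2, v 0 * v 1]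

/-- The coefficients of the quadratic form that is the product of the linear forms `l ⬝ᵥ ·` and
`m ⬝ᵥ ·`. -/
def linearProd {F : Type*} [Field F] (l m : Fin 3 → F) : Fin 6 → F :=
  ![l 0 * m 0, l 1 * m 1, l 2 * m 2, l 1 * m 2 + l 2 * m 1, l 0 * m 2 + l 2 * m 0,
    l 0 * m 1 + l 1 * m 0]

/-- The coefficients of the linear form `B(x, ·)`, where `B` is the polar form
`B(x, y) = Q(x + y) - Q(x) - Q(y)` of `Q`. -/
def polarVec {F : Type*} [Field F] (Q : Fin 6 → F) (x : Fin 3 → F) : Fin 3 → F :=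
  ![2 * Q 0 * x 0 + Q 5 * x 1 + Q 4 * x 2, Q 5 * x 0 + 2 * Q 1 * x 1 + Q 3 * x 2,
    Q 4 * x 0 + Q 3 * x 1 + 2 * Q 2 * x 2]

section
variable {F : Type*} [Field F]

theorem dotProduct_veronese (Q : Fin 6 → F) (v : Fin 3 → F) :
    Q ⬝ᵥ veronese v = Q 0 * v 0 ^ 2 + Q 1 * v 1 ^ 2 + Q 2 * v 2 ^ 2 + Q 3 * (v 1 * v 2)
      + Q 4 * (v 0 * v 2) + Q 5 * (v 0 * v 1) := by
  simp only [dotProduct, Fin.sum_univ_six]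
  rfl

theorem linearProd_dotProduct_veronese (l m v : Fin 3 → F) :
    linearProd l m ⬝ᵥ veronese v = (l ⬝ᵥ v) * (m ⬝ᵥ v) := by
  rw [dotProduct_veronese]
  simp [linearProd, dotProduct, Fin.sum_univ_three]
  ring

theorem dotProduct_veronese_add_smul (Q : Fin 6 → F) (v x : Fin 3 → F) (t : F) :
    Q ⬝ᵥ veronese (v + t • x)
      = Q ⬝ᵥ veronese v + t * (polarVec Q x ⬝ᵥ v) + t ^ 2 * (Q ⬝ᵥ veronese x) := by
  simp only [dotProduct_veronese]
  simp [polarVec, dotProduct, Fin.sum_univ_three]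
  ring

theorem polarVec_dotProduct_self (Q : Fin 6 → F) (x : Fin 3 → F) :
    polarVec Q x ⬝ᵥ x = 2 * (Q ⬝ᵥ veronese x) := by
  rw [dotProduct_veronese]
  simp [polarVec, dotProduct, Fin.sum_univ_three]
  ring

theorem veronese_smul (c : F) (v : Fin 3 → F) : veronese (c • v) = c ^ 2 • veronese v := by
  ext i; fin_cases i <;> simp [veronese] <;> ring

theorem linearProd_comm (l m : Fin 3 → F) : linearProd l m = linearProd m l := by
  ext i; fin_cases i <;> simp [linearProd] <;> ring

theorem linearProd_smul_smul (c d : F) (l m : Fin 3 → F) :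
    linearProd (c • l) (d • m) = (c * d) • linearProd l m := by
  ext i; fin_cases i <;> simp [linearProd] <;> ring

theorem eq_zero_of_forall_dotProduct_veronese {Q : Fin 6 → F}
    (h : ∀ v, Q ⬝ᵥ veronese v = 0) : Q = 0 := by
  simp only [dotProduct_veronese] at h
  have h0 := h ![1, 0, 0]
  have h1 := h ![0, 1, 0]
  have h2 := h ![0, 0, 1]
  have h3 := h ![0, 1, 1]
  have h4 := h ![1, 0, 1]
  have h5 := h ![1, 1, 0]
  simp at h0 h1 h2 h3 h4 h5
  simp [h0, h1, h2] at h3 h4 h5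
  ext i; fin_cases i <;> simp [*]

/-- A quadratic form that vanishes on the plane `l = 0` is divisible by `l`. -/
theorem exists_eq_linearProd {Q : Fin 6 → F} {l : Fin 3 → F} (hl : l ≠ 0)
    (h : ∀ v, l ⬝ᵥ v = 0 → Q ⬝ᵥ veronese v = 0) : ∃ m, Q = linearProd l m := by
  simp only [dotProduct_veronese] at h
  simp only [dotProduct, Fin.sum_univ_three] at h
  obtain ⟨i, hi⟩ := Function.ne_iff.1 hl
  fin_cases i <;> simp at hi
  -- In each case the three vectors are a basis of the plane `l = 0` and the sum of that basis.
  · have h1 := h ![-l 1, l 0, 0] (by simp; ring)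
    have h2 := h ![-l 2, 0, l 0] (by simp; ring)
    have h3 := h ![-l 1 - l 2, l 0, l 0] (by simp; ring)
    simp at h1 h2 h3
    refine ⟨![Q 0 / l 0, (Q 5 - l 1 * (Q 0 / l 0)) / l 0, (Q 4 - l 2 * (Q 0 / l 0)) / l 0], ?_⟩
    ext i; fin_cases i <;> simp [linearProd] <;> field_simp
    · linear_combination h1
    · linear_combination h2
    · linear_combination h3 - h1 - h2
    · ring
    · ring
  · have h1 := h ![l 1, -l 0, 0] (by simp; ring)
    have h2 := h ![0, -l 2, l 1] (by simp; ring)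
    have h3 := h ![l 1, -l 0 - l 2, l 1] (by simp; ring)
    simp at h1 h2 h3
    refine ⟨![(Q 5 - l 0 * (Q 1 / l 1)) / l 1, Q 1 / l 1, (Q 3 - l 2 * (Q 1 / l 1)) / l 1], ?_⟩
    ext i; fin_cases i <;> simp [linearProd] <;> field_simp
    · linear_combination h1
    · linear_combination h2
    · ring
    · linear_combination h3 - h1 - h2
    · ring
  · have h1 := h ![l 2, 0, -l 0] (by simp; ring)
    have h2 := h ![0, l 2, -l 1] (by simp; ring)
    have h3 := h ![l 2, l 2, -l 0 - l 1] (by simp; ring)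
    simp at h1 h2 h3
    refine ⟨![(Q 4 - l 0 * (Q 2 / l 2)) / l 2, (Q 3 - l 1 * (Q 2 / l 2)) / l 2, Q 2 / l 2], ?_⟩
    ext i; fin_cases i <;> simp [linearProd] <;> field_simp
    · linear_combination h1
    · linear_combination h2
    · ring
    · ring
    · linear_combination h3 - h1 - h2
theorem finrank_ker_dotProduct {l : Fin 3 → F} (hl : l ≠ 0) :
    Module.finrank F (LinearMap.ker (dotProductBilin F F l)) = 2 := by
  have h := Module.Dual.finrank_ker_add_one_of_ne_zero (f := dotProductBilin F F l) (by
    intro h0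
    refine hl (dotProduct_eq_zero_iff.1 fun w => ?_)
    exact LinearMap.congr_fun h0 w)
  simpa using h

end

/-! ### Forms with more than `q ^ 2` zeros -/

section
variable {F : Type*} [Field F] [Fintype F] [DecidableEq F]

theorem card_filter_dotProduct_eq_zero {l : Fin 3 → F} (hl : l ≠ 0) :
    #{v : Fin 3 → F | l ⬝ᵥ v = 0} = Fintype.card F ^ 2 := by
  classical
  rw [← finrank_ker_dotProduct hl, ← Module.card_eq_pow_finrank, Fintype.card_subtype]
  exact congrArg card (by ext v; simp)

theorem card_zeros_of_linearProd_smul {l : Fin 3 → F} (hl : l ≠ 0) (c : F) (hc : c ≠ 0) :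
    #{v : Fin 3 → F | linearProd l (c • l) ⬝ᵥ veronese v = 0} = Fintype.card F ^ 2 := by
  simp [linearProd_dotProduct_veronese, hc, card_filter_dotProduct_eq_zero hl]

/-- If every zero of `Q` is singular, then the zeros form a subspace; having more than `q ^ 2`
elements, it is the whole space. -/
theorem eq_zero_of_polarVec_eq_zero {Q : Fin 6 → F}
    (hQ : Fintype.card F ^ 2 < #{v : Fin 3 → F | Q ⬝ᵥ veronese v = 0})
    (h : ∀ x, Q ⬝ᵥ veronese x = 0 → polarVec Q x = 0) : Q = 0 := by
  classical
  let W : Submodule F (Fin 3 → F) :=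
    { carrier := {v | Q ⬝ᵥ veronese v = 0}
      zero_mem' := by simp [dotProduct_veronese]
      add_mem' := fun {a b} ha hb => by
        simp only [Set.mem_ofPred_eq] at ha hb ⊢
        have := dotProduct_veronese_add_smul Q a b 1
        simpa [ha, hb, h b hb] using this
      smul_mem' := fun c v hv => by
        simp only [Set.mem_ofPred_eq] at hv ⊢
        simp [veronese_smul, hv] }
  have hW : Fintype.card W = #{v : Fin 3 → F | Q ⬝ᵥ veronese v = 0} := by
    rw [Fintype.card_subtype]
    exact congrArg card (by ext v; simp only [mem_filter, mem_univ, true_and]; rfl)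
  rw [← hW, Module.card_eq_pow_finrank (K := F) (V := W)] at hQ
  have h2 := (Nat.pow_lt_pow_iff_right Fintype.one_lt_card).1 hQ
  have htop : W = ⊤ := Submodule.eq_top_of_finrank_eq (by
    have := W.finrank_le
    simp only [Module.finrank_fin_fun] at this ⊢
    omega)
  exact eq_zero_of_forall_dotProduct_veronese fun v => (htop ▸ Submodule.mem_top : v ∈ W)

/-- A line parallel to a zero `x` that does not lie in the tangent plane at `x` contains at most one
zero of `Q`, as `Q` restricts to a nonconstant affine function on it. -/
theorem card_zeros_off_tangent_mul {Q : Fin 6 → F} {x : Fin 3 → F} (hx : Q ⬝ᵥ veronese x = 0)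
    (hl : polarVec Q x ≠ 0) :
    #{v : Fin 3 → F | Q ⬝ᵥ veronese v = 0 ∧ polarVec Q x ⬝ᵥ v ≠ 0} * Fintype.card F
      + Fintype.card F ^ 2 ≤ Fintype.card F ^ 3 := by
  have hlx : polarVec Q x ⬝ᵥ x = 0 := by rw [polarVec_dotProduct_self, hx, mul_zero]
  have h1 : #(({v | Q ⬝ᵥ veronese v = 0 ∧ polarVec Q x ⬝ᵥ v ≠ 0} : Finset (Fin 3 → F)) ×ˢ
      (univ : Finset F))
      ≤ #{v : Fin 3 → F | polarVec Q x ⬝ᵥ v ≠ 0} := by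
    refine card_le_card_of_injOn (fun p => p.1 + p.2 • x) ?_ ?_
    · rintro ⟨v, t⟩ hv
      simp at hv
      simp [hlx, hv.2]
    · rintro ⟨v, t⟩ hv ⟨w, s⟩ hw hvw
      simp at hv hw hvw
      have hw' : w = v + (t - s) • x := by
        rw [sub_smul, ← add_sub_assoc, hvw, add_sub_cancel_right]
      have h2 := dotProduct_veronese_add_smul Q v x (t - s)
      rw [← hw', hw.1, hv.1, hx] at h2
      have hts : t - s = 0 := by simpa [hv.2] using h2
      simp [hw', sub_eq_zero.1 hts]
  have h3 := card_filter_add_card_filter_not (s := (univ : Finset (Fin 3 → F)))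
    (fun v => polarVec Q x ⬝ᵥ v = 0)
  rw [card_filter_dotProduct_eq_zero hl] at h3
  rw [card_product, card_univ] at h1
  simp at h3 h1 ⊢
  omega

/-- A form with more than `q ^ 2` zeros vanishes on the tangent plane at each of its nonsingular
zeros. -/
theorem vanishes_on_tangent {Q : Fin 6 → F} {x : Fin 3 → F} (hx : Q ⬝ᵥ veronese x = 0)
    (hl : polarVec Q x ≠ 0)
    (hQ : Fintype.card F ^ 2 < #{v : Fin 3 → F | Q ⬝ᵥ veronese v = 0}) (v : Fin 3 → F)
    (hv : polarVec Q x ⬝ᵥ v = 0) : Q ⬝ᵥ veronese v = 0 := by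
  have hlx : polarVec Q x ⬝ᵥ x = 0 := by rw [polarVec_dotProduct_self, hx, mul_zero]
  have hx0 : x ≠ 0 := by
    rintro rfl
    exact hl (by ext i; fin_cases i <;> simp [polarVec])
  obtain ⟨y, hy, hyx⟩ :
      ∃ y ∈ ({v | Q ⬝ᵥ veronese v = 0 ∧ polarVec Q x ⬝ᵥ v = 0} : Finset (Fin 3 → F)),
        y ∉ univ.image (fun t : F => t • x) := by
    refine exists_mem_notMem_of_card_lt_card ?_
    have h1 := card_zeros_off_tangent_mul hx hl
    have h2 := card_filter_add_card_filter_not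
      (s := ({v | Q ⬝ᵥ veronese v = 0} : Finset (Fin 3 → F)))
      (fun v => polarVec Q x ⬝ᵥ v = 0)
    simp only [filter_filter] at h2
    have h3 : #(univ.image (fun t : F => t • x)) ≤ Fintype.card F := card_image_le
    have hq : 0 < Fintype.card F := Fintype.card_pos
    by_contra! h4
    change #{v | Q ⬝ᵥ veronese v = 0 ∧ polarVec Q x ⬝ᵥ v = 0} +
      #{v | Q ⬝ᵥ veronese v = 0 ∧ polarVec Q x ⬝ᵥ v ≠ 0} = _ at h2
    nlinarith
  simp only [mem_filter, mem_univ, true_and] at hy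
  -- `Q` vanishes at `x` and `y`, and `B(x, y) = 0`, so `Q` vanishes on their span.
  have hli : LinearIndependent F ![x, y] := by
    rw [LinearIndependent.pair_iff' hx0]
    intro a ha
    exact hyx (mem_image.2 ⟨a, mem_univ _, ha⟩)
  have hspan : Submodule.span F (Set.range ![x, y]) =
      LinearMap.ker (dotProductBilin F F (polarVec Q x)) := by
    refine Submodule.eq_of_le_of_finrank_eq ?_ ?_
    · rw [Submodule.span_le]
      rintro _ ⟨i, rfl⟩
      fin_cases i
      · exact hlx
      · exact hy.2
    · rw [finrank_span_eq_card hli, finrank_ker_dotProduct hl, Fintype.card_fin]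
  have hv' : v ∈ Submodule.span F (Set.range ![x, y]) := hspan ▸ hv
  rw [Matrix.range_cons, Matrix.range_cons, Matrix.range_empty, Set.union_empty,
    Set.singleton_union, Submodule.mem_span_pair] at hv'
  obtain ⟨a, b, rfl⟩ := hv'
  rw [add_comm, dotProduct_veronese_add_smul, hx, veronese_smul]
  simp [hy.1, hy.2]

theorem exists_linearIndependent_eq_linearProd {Q : Fin 6 → F} (hQ0 : Q ≠ 0)
    (hQ : Fintype.card F ^ 2 < #{v : Fin 3 → F | Q ⬝ᵥ veronese v = 0}) :
    ∃ s : Fin 2 → Fin 3 → F, LinearIndependent F s ∧ linearProd (s 0) (s 1) = Q := by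
  obtain ⟨x, hx, hl⟩ : ∃ x, Q ⬝ᵥ veronese x = 0 ∧ polarVec Q x ≠ 0 := by
    by_contra! h
    exact hQ0 (eq_zero_of_polarVec_eq_zero hQ h)
  obtain ⟨m, hm⟩ := exists_eq_linearProd hl (vanishes_on_tangent hx hl hQ)
  refine ⟨![polarVec Q x, m], ?_, hm.symm⟩
  rw [LinearIndependent.pair_iff' hl]
  rintro c rfl
  generalize polarVec Q x = l at *
  subst hm
  rcases eq_or_ne c 0 with rfl | hc
  · exact hQ0 (by ext i; fin_cases i <;> simp [linearProd])
  · exact hQ.ne' (card_zeros_of_linearProd_smul hl c hc)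

/-! ### Counting products of two linear forms -/

omit [DecidableEq F] in
/-- The product of two independent linear forms `l`, `m` is also the product of `c • l` and
`c⁻¹ • m` and of `c • m` and `c⁻¹ • l`, for every unit `c`. -/
theorem two_mul_le_card_fiber {s : Fin 2 → Fin 3 → F} (hs : LinearIndependent F s) :
    2 * (Fintype.card F - 1) ≤
      Nat.card {r : Fin 2 → Fin 3 → F // LinearIndependent F r ∧
        linearProd (r 0) (r 1) = linearProd (s 0) (s 1)} := by
  have hpair := LinearIndependent.pair_iff.1 (show LinearIndependent F ![s 0, s 1] by
    rwa [show ![s 0, s 1] = s by ext i; fin_cases i <;> rfl])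
  have hcomb : ∀ a b c d : F, a • s 0 + b • s 1 = c • s 0 + d • s 1 → a = c ∧ b = d := by
    intro a b c d h
    have h2 := hpair (a - c) (b - d) (by rw [sub_smul, sub_smul, sub_add_sub_comm, h, sub_self])
    exact ⟨sub_eq_zero.1 h2.1, sub_eq_zero.1 h2.2⟩
  -- The two summands are the two orders of the factors.
  let g : Fˣ ⊕ Fˣ → {r : Fin 2 → Fin 3 → F // LinearIndependent F r ∧
        linearProd (r 0) (r 1) = linearProd (s 0) (s 1)} := Sum.elim
    (fun c => ⟨![(c : F) • s 0, (↑c⁻¹ : F) • s 1], by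
      refine LinearIndependent.pair_iff.2 fun a b h => ?_
      have := hpair (a * c) (b * (↑c⁻¹ : F)) (by rw [mul_smul, mul_smul]; exact h)
      simpa using this, by simp [linearProd_smul_smul]⟩)
    (fun c => ⟨![(c : F) • s 1, (↑c⁻¹ : F) • s 0], by
      refine LinearIndependent.pair_iff.2 fun a b h => ?_
      have := hpair (b * (↑c⁻¹ : F)) (a * c) (by rw [mul_smul, mul_smul, add_comm]; exact h)
      simpa [and_comm] using this, by simp [linearProd_smul_smul, linearProd_comm (s 1)]⟩)
  have hg : Function.Injective g := by
    rintro (c | c) (d | d) h <;>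
      have h0 := congrFun (congrArg Subtype.val h) 0 <;> simp [g] at h0
    · have := hcomb c 0 d 0 (by simpa using h0)
      rw [Units.ext this.1]
    · have := hcomb c 0 0 d (by simpa using h0)
      exact absurd this.1 c.ne_zero
    · have := hcomb 0 c d 0 (by simpa using h0)
      exact absurd this.2 c.ne_zero
    · have := hcomb 0 c 0 d (by simpa using h0)
      rw [Units.ext this.2]
  have h := Nat.card_le_card_of_injective g hg
  rw [Nat.card_sum, Nat.card_units, Nat.card_eq_fintype_card] at h
  omega

theorem two_mul_card_le_of_forall_exists_linearProd (P : Finset (Fin 6 → F))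
    (hP : ∀ Q ∈ P, ∃ s : Fin 2 → Fin 3 → F,
      LinearIndependent F s ∧ linearProd (s 0) (s 1) = Q) :
    2 * (Fintype.card F - 1) * #P ≤
      (Fintype.card F ^ 3 - 1) * (Fintype.card F ^ 3 - Fintype.card F) := by
  classical
  let E : Finset (Fin 2 → Fin 3 → F) := {s | LinearIndependent F s}
  have hE : #E = (Fintype.card F ^ 3 - 1) * (Fintype.card F ^ 3 - Fintype.card F) := by
    have h := card_linearIndependent (K := F) (V := Fin 3 → F) (k := 2) (by simp)
    rw [Nat.card_eq_fintype_card, Fintype.card_subtype] at h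
    simpa [Fin.prod_univ_two] using h
  rw [← hE, mul_comm]
  calc #P * (2 * (Fintype.card F - 1))
      ≤ ∑ Q ∈ P, #{s ∈ E | linearProd (s 0) (s 1) = Q} := by
        rw [← smul_eq_mul]
        refine card_nsmul_le_sum _ _ _ fun Q hQ => ?_
        obtain ⟨s, hs, rfl⟩ := hP Q hQ
        have h := two_mul_le_card_fiber hs
        rwa [Nat.card_eq_fintype_card, Fintype.card_subtype, ← filter_filter] at h
    _ ≤ #E := by
        rw [← card_biUnion]
        · exact card_le_card (biUnion_subset.2 fun Q _ => filter_subset _ _)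
        · intro Q _ R _ hQR
          exact disjoint_filter.2 fun s _ h1 h2 => hQR (h1.symm.trans h2)

/-! ### Eigenvalues of the rank-one graph -/

theorem sum_subtype_ne_eq_sub {α M : Type*} [Fintype α] [DecidableEq α] [AddCommGroup M]
    (f : α → M) (a : α) : ∑ x : {x // x ≠ a}, f x = ∑ x, f x - f a := by
  rw [← Finset.sum_subtype (univ.erase a) (by simp) f, eq_sub_iff_add_eq,
    sum_erase_add _ _ (mem_univ a)]

theorem sum_units_addChar_mul {ψ : AddChar F ℂ} (hψ : ψ.IsPrimitive) (a : F) :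
    ∑ c : Fˣ, ψ (c * a) = (if a = 0 then (Fintype.card F : ℂ) else 0) - 1 := by
  rw [Fintype.sum_equiv unitsEquivNeZero (fun c : Fˣ => ψ (c * a))
    (fun c : {c : F // c ≠ 0} => ψ (c * a)) (fun _ => rfl),
    sum_subtype_ne_eq_sub (fun c : F => ψ (c * a)), AddChar.sum_mulShift a hψ]
  simp

/-- The eigenvalue of the rank-one graph at a quadratic form with at most `q ^ 2` zeros is
negative. -/
theorem re_sum_veronese_neg {ψ : AddChar F ℂ} (hψ : ψ.IsPrimitive) {Q : Fin 6 → F}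
    (hQ : #{v : Fin 3 → F | Q ⬝ᵥ veronese v = 0} ≤ Fintype.card F ^ 2) :
    (∑ s : {v : Fin 3 → F // v ≠ 0} × Fˣ, ψ (Q ⬝ᵥ ((s.2 : F) • veronese s.1.1))).re < 0 := by
  have h1 : ∑ s : {v : Fin 3 → F // v ≠ 0} × Fˣ, ψ (Q ⬝ᵥ ((s.2 : F) • veronese s.1.1))
      = (Fintype.card F : ℂ) * #{v : Fin 3 → F | Q ⬝ᵥ veronese v = 0} - Fintype.card F ^ 3
        - (Fintype.card F - 1) := by
    simp only [Fintype.sum_prod_type, dotProduct_smul, smul_eq_mul, sum_units_addChar_mul hψ]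
    have hv0 : Q ⬝ᵥ veronese (0 : Fin 3 → F) = 0 := by simp [dotProduct_veronese]
    rw [sum_subtype_ne_eq_sub (fun v : Fin 3 → F =>
      (if Q ⬝ᵥ veronese v = 0 then (Fintype.card F : ℂ) else 0) - 1), if_pos hv0,
      sum_sub_distrib, ← sum_filter, sum_const, sum_const]
    simp [mul_comm]
  rw [h1]
  have hq : (1 : ℝ) < Fintype.card F := by exact_mod_cast Fintype.one_lt_card
  have h3 : (#{v : Fin 3 → F | Q ⬝ᵥ veronese v = 0} : ℝ) ≤ (Fintype.card F : ℝ) ^ 2 := by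
    exact_mod_cast hQ
  have h4 : ((Fintype.card F : ℂ) * #{v : Fin 3 → F | Q ⬝ᵥ veronese v = 0} - Fintype.card F ^ 3
        - (Fintype.card F - 1)) = (((Fintype.card F : ℝ) * #{v : Fin 3 → F | Q ⬝ᵥ veronese v = 0}
          - Fintype.card F ^ 3 - (Fintype.card F - 1) : ℝ) : ℂ) := by push_cast; rfl
  rw [h4, Complex.ofReal_re]
  nlinarith
end

/-- The number of ternary quadratic forms with more than `q ^ 2` zeros, the zero form included. -/
theorem card_filter_sq_lt_card_zeros_le {F : Type*} [Field F] [Fintype F] [DecidableEq F] :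
    (#{Q : Fin 6 → F | Fintype.card F ^ 2 < #{v : Fin 3 → F | Q ⬝ᵥ veronese v = 0}} : ℚ) ≤
      (Fintype.card F : ℚ) * ((Fintype.card F : ℚ) ^ 2 - 1) *
        ((Fintype.card F : ℚ) ^ 2 + Fintype.card F + 1) / 2 + 1 := by
  set P : Finset (Fin 6 → F) :=
    {Q | Fintype.card F ^ 2 < #{v : Fin 3 → F | Q ⬝ᵥ veronese v = 0}} with hP
  have h1 := two_mul_card_le_of_forall_exists_linearProd (P.erase 0) fun Q hQ =>
    exists_linearIndependent_eq_linearProd (mem_erase.1 hQ).1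
      (mem_filter.1 (mem_erase.1 hQ).2).2
  have h2 : #P ≤ #(P.erase 0) + 1 := by
    have := pred_card_le_card_erase (s := P) (a := 0)
    omega
  have hq : 1 < Fintype.card F := Fintype.one_lt_card
  generalize Fintype.card F = q at *
  generalize #(P.erase 0) = p at *
  generalize #P = r at *
  have h3 : (1 : ℚ) < q := by exact_mod_cast hq
  have h4 : (r : ℚ) ≤ p + 1 := by exact_mod_cast h2
  have h5 : (2 * ((q : ℚ) - 1) * p) ≤ ((q : ℚ) ^ 3 - 1) * ((q : ℚ) ^ 3 - q) := by
    have := (Nat.cast_le (α := ℚ)).2 h1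
    have e1 : 1 ≤ q ^ 3 := Nat.one_le_pow _ _ (by omega)
    have e2 : q ≤ q ^ 3 := Nat.le_self_pow (by norm_num) q
    push_cast [Nat.cast_sub hq.le, Nat.cast_sub e1, Nat.cast_sub e2] at this
    exact this
  have h6 : 0 ≤ ((q : ℚ) - 1) * (q * (q ^ 2 - 1) * (q ^ 2 + q + 1) / 2 - p) := by
    linear_combination h5 / 2
  have h7 := nonneg_of_mul_nonneg_right h6 (sub_pos.2 h3)
  linarith

/-! ### Symmetric matrices -/

/-- The entries of a symmetric matrix on and above the diagonal, ordered so that `v vᵀ` is sent to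
`veronese v`. -/
def symCoord {F : Type*} (A : SymMat 3 F) : Fin 6 → F :=
  ![A.1 0 0, A.1 1 1, A.1 2 2, A.1 1 2, A.1 0 2, A.1 0 1]

theorem symCoord_injective {F : Type*} : Function.Injective (symCoord (F := F)) := by
  rintro ⟨A, hA⟩ ⟨B, hB⟩ h
  have h' := congrFun h
  simp only [symCoord, Fin.forall_fin_succ] at h'
  simp at h'
  obtain ⟨h0, h1, h2, h3, h4, h5⟩ := h'
  have e1 := hA.apply 0 1
  have e2 := hA.apply 0 2
  have e3 := hA.apply 1 2
  have f1 := hB.apply 0 1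
  have f2 := hB.apply 0 2
  have f3 := hB.apply 1 2
  ext i j
  fin_cases i <;> fin_cases j <;> simp [*]

theorem rankDist_le_one_of_symCoord_eq {F : Type*} [Field F] {A B : SymMat 3 F} {c : F}
    {v : Fin 3 → F} (h : symCoord A - symCoord B + c • veronese v = 0) : rankDist A B ≤ 1 := by
  have key : A.1 - B.1 = Matrix.vecMulVec (-c • v) v := by
    have h' := congrFun h
    simp only [symCoord, veronese, Fin.forall_fin_succ] at h'
    simp at h'
    obtain ⟨h0, h1, h2, h3, h4, h5⟩ := h'
    have e1 := A.2.apply 0 1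
    have e2 := A.2.apply 0 2
    have e3 := A.2.apply 1 2
    have f1 := B.2.apply 0 1
    have f2 := B.2.apply 0 2
    have f3 := B.2.apply 1 2
    ext i j
    fin_cases i <;> fin_cases j <;> simp [Matrix.vecMulVec_apply, *] <;>
    first
      | linear_combination h0
      | linear_combination h1
      | linear_combination h2
      | linear_combination h3
      | linear_combination h4
      | linear_combination h5
  rw [rankDist, key]
  exact Matrix.rank_vecMulVec_le _ _

theorem veronese_eq_zero_iff {F : Type*} [Field F] {v : Fin 3 → F} : veronese v = 0 ↔ v = 0 := by
  constructor
  · intro h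
    have h' := congrFun h
    simp only [veronese, Fin.forall_fin_succ] at h'
    simp at h'
    ext i; fin_cases i <;> simp [h']
  · rintro rfl
    ext i; fin_cases i <;> simp [veronese]

/-- Codes of minimum distance `d ≥ 2` are covered; `d = 2` is the case of `2`-codes proper. -/
theorem mainTheorem3 {F : Type*} [Field F] [Fintype F] (q : ℕ) (hq : Fintype.card F = q)
    (C : Set (SymMat 3 F)) (d : ℕ∞) (hd : 2 ≤ d) (hC : IsDCode d C) :
    (C.ncard : ℚ) ≤ (q : ℚ) * ((q : ℚ) ^ 2 - 1) * ((q : ℚ) ^ 2 + q + 1) / 2 + 1 := by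
  classical
  subst hq
  have hdist : ∀ A ∈ C, ∀ B ∈ C, A ≠ B → 2 ≤ rankDist A B := by
    intro A hA B hB hAB
    have h : minRankDist C ≤ (rankDist A B : ℕ∞) :=
      iInf₂_le_of_le A hA (iInf₂_le_of_le B hB (iInf_le _ hAB))
    rw [hC.minDist] at h
    exact_mod_cast hd.trans h
  obtain ⟨ψ, hψ⟩ : ∃ ψ : AddChar F ℂ, ψ.IsPrimitive := by
    exact ⟨_, AddChar.FiniteField.primitiveChar_to_Complex_isPrimitive F⟩
  have hcard : #(C.toFinset.image symCoord) = C.ncard := by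
    rw [card_image_of_injective _ symCoord_injective, Set.ncard_eq_toFinset_card']
  refine le_trans ?_ card_filter_sq_lt_card_zeros_le
  rw [← hcard, Nat.cast_le]
  refine card_le_of_re_eigenvalue_neg hψ
    (fun s : {v : Fin 3 → F // v ≠ 0} × Fˣ => (s.2 : F) • veronese s.1.1) _ _ ?_ ?_
  · simp only [mem_image, Set.mem_toFinset]
    rintro _ ⟨A, hA, rfl⟩ _ ⟨B, hB, rfl⟩ ⟨⟨v, hv⟩, c⟩ h
    have hAB : A ≠ B := by
      rintro rfl
      rw [sub_self, zero_add] at h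
      exact hv (veronese_eq_zero_iff.1 ((smul_eq_zero.1 h).resolve_left c.ne_zero))
    have h1 := rankDist_le_one_of_symCoord_eq h
    have h2 := hdist A hA B hB hAB
    omega
  · intro Q hQ
    exact re_sum_veronese_neg hψ (by simpa using hQ)
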